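/- Let agents $1,\dots,m$ have convex objective functions $f_i:\mathbb R^n\to\mathbb R$ and closed convex constraint sets $X_i\subseteq\mathbb R^n$, let $\alpha(k)>0$ be stepsizes, and let $x_i(0)\in X_i$ be given (deterministic) initial estimates. Let $(\xi(k))_{k\ge 0}$ be independent random elements of a measurable space $\Omega'$, defined on a probability space $(\Omega,\mathcal F,P)$, and let $\psi:(\mathbb R^n)^m\times\Omega'\to\mathbb R^{m\times m}$ be measurable. The projected multi-agent subgradient algorithm generates, with $x(k)=(x_1(k),\dots,x_m(k))$, $$A(k)=[a_{ij}(k)]=\psi(x(k),\xi(k)),\qquad v_i(k)=\sum_{j=1}^m a_{ij}(k)x_j(k),\qquad x_i(k+1)=P_{X_i}\big[v_i(k)-\alpha(k)d_i(k)\big],$$ where $P_{X_i}$ is Euclidean projection onto $X_i$ and $d_i(k)$ is a subgradient of $f_i$ at $v_i(k)$, chosen as a measurable function of $\xi(0),\dots,\xi(k)$. Put $y(k)=\frac1m\sum_{j=1}^m x_j(k)$. Assume: 1. (Bounded subgradients) there is $L>0$ such that $\|s\|\le L$ for every $i$, every $x\in\mathbb R^n$ and every $s\in\partial f_i(x)$;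 2. (Connectivity and state-dependent communication) there are a strongly connected directed graph $(\{1,\dots,m\},\mathcal E)$ and constants $\gamma>0$, $K>0$, $C>0$, $\delta\in(0,1]$ such that for all $(j,i)\in\mathcal E$, all $k\ge0$ and all $\bar x\in(\mathbb R^n)^m$, $$P\big(a_{ij}(k)\ge\gamma\mid x(k)=\bar x\big)=P\big(\psi(\bar x,\xi(k))_{ij}\ge\gamma\big)\ \ge\ \min\Big\{\delta,\frac{K}{\|\bar x_i-\bar x_j\|^C}\Big\},$$ the right-hand side being $\delta$ when $\bar x_i=\bar x_j$; 3. (Doubly stochastic weights) with probability one, $A(k)$ is doubly stochastic for all $k\ge 0$; 4. (Self confidence) with probability one, $a_{ii}(k)\ge\gamma$ for all $i$ and all $k\ge 0$, with the same $\gamma$; 5. (Identical sets) $X_i=X$ for all $i$, for one closed convex set $X$; 6. (Limiting stepsizes) $\lim_{k\to\infty}k\,\log^p(k)\,\alpha(k)=0$ for every real $p<1$. Then for every agent $i$ each $\|x_i(k)-y(k)\|$ is integrable, $$\lim_{k\to\infty}E\big[\|x_i(k)-y(k)\|\big]=0,\qquad\text{and}\qquad \liminf_{k\to\infty}\|x_i(k)-y(k)\|=0\quad\text{with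 probability one.}$$ -/

import Mathlib

open MeasureTheory ProbabilityTheory Filter Topology
open scoped BigOperators ENNReal

namespace DistSubgrad

/-- `s` is a subgradient at `x` of the (finite-valued) function `F`. -/
def IsSubgradientAt {n : ℕ} (F : EuclideanSpace ℝ (Fin n) → ℝ)
    (x s : EuclideanSpace ℝ (Fin n)) : Prop :=
  ∀ z, F x + inner ℝ s (z - x) ≤ F z

/-- `p` is a point of `X` nearest to `u`. -/
def IsNearestPoint {n : ℕ} (X : Set (EuclideanSpace ℝ (Fin n)))
    (u p : EuclideanSpace ℝ (Fin n)) : Prop :=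
  p ∈ X ∧ ∀ z ∈ X, ‖u - p‖ ≤ ‖u - z‖

/-- The Euclidean projection `P_X[u] = argmin_{z ∈ X} ‖u - z‖`. For nonempty closed convex `X` the
minimizer exists and is unique, see `projOn_spec` and `IsNearestPoint.eq_projOn`. -/
noncomputable def projOn {n : ℕ} (X : Set (EuclideanSpace ℝ (Fin n)))
    (u : EuclideanSpace ℝ (Fin n)) : EuclideanSpace ℝ (Fin n) :=
  Classical.epsilon (IsNearestPoint X u)

theorem projOn_spec {n : ℕ} {X : Set (EuclideanSpace ℝ (Fin n))} (hne : X.Nonempty)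
    (hcl : IsClosed X) (hcv : Convex ℝ X) (u : EuclideanSpace ℝ (Fin n)) :
    IsNearestPoint X u (projOn X u) := by
  apply Classical.epsilon_spec (p := IsNearestPoint X u)
  obtain ⟨p, hp, h⟩ := exists_norm_eq_iInf_of_complete_convex hne hcl.isComplete hcv u
  refine ⟨p, hp, fun z hz => ?_⟩
  rw [h]
  exact ciInf_le (f := fun w : X => ‖u - w‖) ⟨0, Set.forall_mem_range.2 fun _ => norm_nonneg _⟩
    ⟨z, hz⟩

theorem IsNearestPoint.eq_projOn {n : ℕ} {X : Set (EuclideanSpace ℝ (Fin n))}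
    (hcl : IsClosed X) (hcv : Convex ℝ X) {u p : EuclideanSpace ℝ (Fin n)}
    (hp : IsNearestPoint X u p) : p = projOn X u := by
  have hq := projOn_spec ⟨p, hp.1⟩ hcl hcv u
  have key : ∀ r, IsNearestPoint X u r → ∀ w ∈ X, inner ℝ (u - r) (w - r) ≤ 0 := by
    intro r hr
    apply (norm_eq_iInf_iff_real_inner_le_zero hcv hr.1).1
    have : Nonempty X := ⟨⟨r, hr.1⟩⟩
    exact le_antisymm (le_ciInf fun z => hr.2 z z.2)
      (ciInf_le (f := fun w : X => ‖u - w‖) ⟨0, Set.forall_mem_range.2 fun _ => norm_nonneg _⟩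
        ⟨r, hr.1⟩)
  have h1 := key p hp _ hq.1
  have h2 := key _ hq p hp.1
  set q := projOn X u
  have h3 : inner ℝ (u - q) (p - q) + inner ℝ (u - p) (q - p) = ‖p - q‖ ^ 2 := by
    have e1 : q - p = -(p - q) := by abel
    have e2 : u - q = (u - p) + (p - q) := by abel
    rw [e1, e2, inner_add_left, inner_neg_right, real_inner_self_eq_norm_sq]
    ring
  have h4 : ‖p - q‖ ^ 2 ≤ 0 := by linarith
  exact sub_eq_zero.1 (norm_eq_zero.1 (pow_eq_zero_iff two_ne_zero |>.1
    (le_antisymm h4 (sq_nonneg _))))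

/-- `v_i = ∑_j a_ij x_j`. -/
noncomputable def mix {m n : ℕ} (A : Matrix (Fin m) (Fin m) ℝ)
    (x : Fin m → EuclideanSpace ℝ (Fin n)) (i : Fin m) : EuclideanSpace ℝ (Fin n) :=
  ∑ j, A i j • x j

/-- The projected multi-agent subgradient algorithm. The states are
`x_i(0) = x₀ i` and `x_i(k+1) = P_{X_i}[v_i(k) - α(k) d_i(k)]`, where `v_i(k) = ∑_j a_ij(k) x_j(k)`
and the communication matrix is `A(k) = ψ(x(k), ξ(k))`. -/
noncomputable def state {m n : ℕ} {Ω Ω' : Type*} (X : Fin m → Set (EuclideanSpace ℝ (Fin n)))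
    (ψ : (Fin m → EuclideanSpace ℝ (Fin n)) → Ω' → Matrix (Fin m) (Fin m) ℝ) (ξ : ℕ → Ω → Ω')
    (α : ℕ → ℝ) (d : ℕ → Ω → Fin m → EuclideanSpace ℝ (Fin n))
    (x₀ : Fin m → EuclideanSpace ℝ (Fin n)) :
    ℕ → Ω → Fin m → EuclideanSpace ℝ (Fin n)
  | 0, _ => x₀
  | k + 1, ω => fun i =>
      projOn (X i) (mix (ψ (state X ψ ξ α d x₀ k ω) (ξ k ω)) (state X ψ ξ α d x₀ k ω) i
        - α k • d k ω i)

/-- The communication matrix `A(k) = ψ(x(k), ξ(k))` along the algorithm. -/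
noncomputable def commMatrix {m n : ℕ} {Ω Ω' : Type*} (X : Fin m → Set (EuclideanSpace ℝ (Fin n)))
    (ψ : (Fin m → EuclideanSpace ℝ (Fin n)) → Ω' → Matrix (Fin m) (Fin m) ℝ) (ξ : ℕ → Ω → Ω')
    (α : ℕ → ℝ) (d : ℕ → Ω → Fin m → EuclideanSpace ℝ (Fin n))
    (x₀ : Fin m → EuclideanSpace ℝ (Fin n)) (k : ℕ) (ω : Ω) : Matrix (Fin m) (Fin m) ℝ :=
  ψ (state X ψ ξ α d x₀ k ω) (ξ k ω)

/-- The average `y = (1/m) ∑_j x_j`. -/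
noncomputable def average {m n : ℕ} (x : Fin m → EuclideanSpace ℝ (Fin n)) :
    EuclideanSpace ℝ (Fin n) :=
  (m : ℝ)⁻¹ • ∑ j, x j

/-- The σ-algebra generated by `ξ(0), …, ξ(k)`. -/
def history {Ω Ω' : Type*} [MeasurableSpace Ω'] (ξ : ℕ → Ω → Ω') (k : ℕ) : MeasurableSpace Ω :=
  ⨆ r ∈ Set.Iic k, MeasurableSpace.comap (ξ r) inferInstance

/-- Bounded subgradients: one `L > 0` bounds all subgradients of all the `f_i` at all points. -/
def BoundedSubgradients {m n : ℕ} (f : Fin m → EuclideanSpace ℝ (Fin n) → ℝ) : Prop :=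
  ∃ L : ℝ, 0 < L ∧ ∀ i x s, IsSubgradientAt (f i) x s → ‖s‖ ≤ L

/-- Strong connectivity: a directed path (possibly of length zero) from every node to every
node. -/
def StronglyConn {m : ℕ} (G : Digraph (Fin m)) : Prop :=
  ∀ i j, Relation.ReflTransGen G.Adj i j

/-- `min {δ, K / t ^ C}` for `t ≥ 0`, with the convention `K / 0 = ∞`. -/
noncomputable def linkBound (δ K C t : ℝ) : ℝ :=
  if t = 0 then δ else min δ (K / t ^ C)

/-- State-dependent communication: for every edge `(j, i)`, every time `k` and every state `x`,
`P(a_ij(k) ≥ γ | x(k) = x) ≥ min {δ, K / ‖x_i - x_j‖ ^ C}`. As `A(k) = ψ(x(k), ξ(k))` with `ξ(k)`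
independent of `x(k)`, the conditional law of `A(k)` given `x(k) = x` is the law of `ψ(x, ξ(k))`. -/
def CommunicationModel {m n : ℕ} {Ω Ω' : Type*} [MeasurableSpace Ω] (P : Measure Ω)
    (ψ : (Fin m → EuclideanSpace ℝ (Fin n)) → Ω' → Matrix (Fin m) (Fin m) ℝ) (ξ : ℕ → Ω → Ω')
    (G : Digraph (Fin m)) (γ δ K C : ℝ) : Prop :=
  ∀ i j, G.Adj j i → ∀ (k : ℕ) (x : Fin m → EuclideanSpace ℝ (Fin n)),
    linkBound δ K C ‖x i - x j‖ ≤ P.real {ω | γ ≤ ψ x (ξ k ω) i j}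

/-- Limiting stepsizes: `k log^p(k) α(k) → 0` for every real `p < 1`. -/
def LimitingStepsizes (α : ℕ → ℝ) : Prop :=
  ∀ p : ℝ, p < 1 → Tendsto (fun k : ℕ => (k : ℝ) * Real.log k ^ p * α k) atTop (𝓝 0)

end DistSubgrad

/-!
The Lyapunov function is the total squared disagreement `V(x) = ∑ i, ∑ j, ‖x_i - x_j‖ ^ 2`.
Averaging by a doubly stochastic matrix with diagonal entries at least `γ` decreases `V` by at least
`m γ²` times the squared disagreement over the links of weight at least `γ`. Since `ξ(k)` is
independent of `x(k)`, a lower bound `p_k` on the link probabilities turns this into an expected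
relative decrease of order `p_k`, the graph being connected; projecting and moving by a
subgradient step of size `b_k` costs only a term of order `b_k² / p_k`.

If `b_k = O(k ^ (-s))` with `s < 1`, the diameter of the states grows at most like `k ^ (1 - s)`, so
that `p_k` may be taken of order `k ^ (-C (1 - s))`. For `s > C / (C + 1)` we have
`C (1 - s) < s < 1`, hence `p_k` is not summable while `b_k / p_k → 0`: this forces `E[V] → 0`. The
mean deviation then tends to `0` by Cauchy–Schwarz, and the pathwise lower limit vanishes by Fatou.
Limiting stepsizes are `O(1 / k)`, which allows every `s < 1`.
-/

namespace DistSubgrad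

theorem add_sq_le_one_add_mul_sq {η : ℝ} (hη : 0 < η) (a b : ℝ) :
    (a + b) ^ 2 ≤ (1 + η) * a ^ 2 + (1 + η⁻¹) * b ^ 2 := by
  have hdefect :
      (1 + η) * a ^ 2 + (1 + η⁻¹) * b ^ 2 - (a + b) ^ 2 = η⁻¹ * (η * a - b) ^ 2 := by
    field_simp; ring
  linarith [show 0 ≤ η⁻¹ * (η * a - b) ^ 2 by positivity]

theorem norm_sub_le_norm_sub_add {ι E : Type*} [NormedAddCommGroup E] {x v : ι → E} {b : ℝ}
    (h : ∀ i, ‖x i - v i‖ ≤ b) (i j : ι) :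
    ‖x i - x j‖ ≤ ‖v i - v j‖ + 2 * b :=
  calc ‖x i - x j‖ = ‖(v i - v j) + ((x i - v i) - (x j - v j))‖ := by congr 1; abel
    _ ≤ ‖v i - v j‖ + (‖x i - v i‖ + ‖x j - v j‖) :=
      (norm_add_le _ _).trans (by gcongr; exact norm_sub_le _ _)
    _ ≤ ‖v i - v j‖ + 2 * b := by linarith [h i, h j]

section Disagreement

variable {ι E : Type*} [Fintype ι] [NormedAddCommGroup E]

/-- The total squared disagreement of a family of vectors, the Lyapunov function of the
argument. -/
noncomputable def disagreement (x : ι → E) : ℝ :=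
  ∑ i, ∑ j, ‖x i - x j‖ ^ 2

open Classical in
/-- The squared disagreement along the links `j → i` given by `r j i`: the receiving agent is the
second argument of `r` but the first index of a communication matrix. -/
noncomputable def linkDisagreement (r : ι → ι → Prop) (x : ι → E) : ℝ :=
  ∑ i, ∑ j, if r j i then ‖x i - x j‖ ^ 2 else 0

theorem disagreement_nonneg (x : ι → E) : 0 ≤ disagreement x := by
  unfold disagreement; positivity

theorem linkDisagreement_nonneg (r : ι → ι → Prop) (x : ι → E) : 0 ≤ linkDisagreement r x :=
  Finset.sum_nonneg fun i _ => Finset.sum_nonneg fun j _ => by split_ifs <;> positivity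

theorem norm_sub_sq_le_disagreement (x : ι → E) (i j : ι) : ‖x i - x j‖ ^ 2 ≤ disagreement x :=
  (Finset.single_le_sum (f := fun j => ‖x i - x j‖ ^ 2) (fun _ _ => sq_nonneg _)
    (Finset.mem_univ j)).trans <|
  Finset.single_le_sum (f := fun i => ∑ j, ‖x i - x j‖ ^ 2) (fun _ _ => by positivity)
    (Finset.mem_univ i)

theorem norm_sub_sq_le_linkDisagreement {r : ι → ι → Prop} {i j : ι} (hij : r i j) (x : ι → E) :
    ‖x i - x j‖ ^ 2 ≤ linkDisagreement r x := by
  classical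
  calc ‖x i - x j‖ ^ 2 = if r i j then ‖x j - x i‖ ^ 2 else 0 := by rw [if_pos hij, norm_sub_rev]
    _ ≤ ∑ i, if r i j then ‖x j - x i‖ ^ 2 else 0 :=
      Finset.single_le_sum (f := fun i => if r i j then ‖x j - x i‖ ^ 2 else 0)
        (fun _ _ => by split_ifs <;> positivity) (Finset.mem_univ i)
    _ ≤ linkDisagreement r x :=
      Finset.single_le_sum (f := fun j => ∑ i, if r i j then ‖x j - x i‖ ^ 2 else 0)
        (fun _ _ => Finset.sum_nonneg fun _ _ => by split_ifs <;> positivity) (Finset.mem_univ j)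

theorem disagreement_le_of_norm_sub_le {x : ι → E} {D : ℝ} (h : ∀ i j, ‖x i - x j‖ ≤ D) :
    disagreement x ≤ (Fintype.card ι) ^ 2 * D ^ 2 := by
  calc disagreement x ≤ ∑ _i : ι, ∑ _j : ι, D ^ 2 := by
        unfold disagreement; gcongr with i _ j _; exact h i j
    _ = (Fintype.card ι) ^ 2 * D ^ 2 := by
        simp only [Finset.sum_const, Finset.card_univ, nsmul_eq_mul]; ring

theorem disagreement_le_of_perturbation {x v : ι → E} {b η : ℝ} (hη : 0 < η)
    (h : ∀ i, ‖x i - v i‖ ≤ b) :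
    disagreement x
      ≤ (1 + η) * disagreement v + (1 + η⁻¹) * (4 * (Fintype.card ι) ^ 2 * b ^ 2) := by
  have hpair (i j : ι) :
      ‖x i - x j‖ ^ 2 ≤ (1 + η) * ‖v i - v j‖ ^ 2 + (1 + η⁻¹) * (2 * b) ^ 2 :=
    (pow_le_pow_left₀ (norm_nonneg _) (norm_sub_le_norm_sub_add h i j) 2).trans
      (add_sq_le_one_add_mul_sq hη _ _)
  calc disagreement x
      ≤ ∑ i, ∑ j, ((1 + η) * ‖v i - v j‖ ^ 2 + (1 + η⁻¹) * (2 * b) ^ 2) := by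
        unfold disagreement; gcongr with i _ j _; exact hpair i j
    _ = _ := by
        simp only [Finset.sum_add_distrib, ← Finset.mul_sum, disagreement, Finset.sum_const,
          Finset.card_univ, nsmul_eq_mul]
        ring

theorem exists_norm_sub_sq_le_mul_linkDisagreement {r : ι → ι → Prop} {i j : ι}
    (hij : Relation.EqvGen r i j) :
    ∃ c : ℝ, 0 ≤ c ∧ ∀ x : ι → E, ‖x i - x j‖ ^ 2 ≤ c * linkDisagreement r x := by
  induction hij with
  | rel i j hij => exact ⟨1, one_pos.le, fun x => by
      simpa using norm_sub_sq_le_linkDisagreement hij x⟩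
  | refl i => exact ⟨0, le_rfl, fun x => by simp⟩
  | symm i j _ ih => simpa only [norm_sub_rev] using ih
  | trans i j k _ _ ihij ihjk =>
    obtain ⟨c, hc, hcij⟩ := ihij
    obtain ⟨c', hc', hcjk⟩ := ihjk
    refine ⟨2 * (c + c'), by positivity, fun x => ?_⟩
    calc ‖x i - x k‖ ^ 2 ≤ (‖x i - x j‖ + ‖x j - x k‖) ^ 2 := by
          gcongr; exact norm_sub_le_norm_sub_add_norm_sub _ _ _
      _ ≤ 2 * (‖x i - x j‖ ^ 2 + ‖x j - x k‖ ^ 2) := add_sq_le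
      _ ≤ 2 * (c + c') * linkDisagreement r x := by linarith [hcij x, hcjk x]

theorem exists_pos_mul_disagreement_le_linkDisagreement (E : Type*) [NormedAddCommGroup E]
    {r : ι → ι → Prop} (hr : ∀ i j, Relation.EqvGen r i j) :
    ∃ κ : ℝ, 0 < κ ∧ ∀ x : ι → E, κ * disagreement x ≤ linkDisagreement r x := by
  choose c hc hle using fun i j => exists_norm_sub_sq_le_mul_linkDisagreement (E := E) (hr i j)
  have hS : 0 ≤ ∑ i, ∑ j, c i j := Finset.sum_nonneg fun i _ => Finset.sum_nonneg fun j _ => hc i j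
  refine ⟨(∑ i, ∑ j, c i j + 1)⁻¹, by positivity, fun x => ?_⟩
  rw [inv_mul_le_iff₀ (by positivity)]
  calc disagreement x ≤ ∑ i, ∑ j, c i j * linkDisagreement r x := by
        unfold disagreement; gcongr with i _ j _; exact hle i j x
    _ = (∑ i, ∑ j, c i j) * linkDisagreement r x := by simp only [Finset.sum_mul]
    _ ≤ (∑ i, ∑ j, c i j + 1) * linkDisagreement r x := by
        gcongr
        · exact linkDisagreement_nonneg r x
        · exact le_add_of_nonneg_right zero_le_one

theorem measurable_disagreement [MeasurableSpace E] [BorelSpace E] [SecondCountableTopology E] :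
    Measurable (disagreement : (ι → E) → ℝ) := by
  unfold disagreement; fun_prop

end Disagreement

section Averaging

variable {ι E : Type*} [Fintype ι] [NormedAddCommGroup E]

theorem mul_linkDisagreement_le_sum {A : Matrix ι ι ℝ} (hA : ∀ i j, 0 ≤ A i j) {γ : ℝ} (hγ : 0 ≤ γ)
    (hdiag : ∀ i, γ ≤ A i i) (x : ι → E) :
    γ ^ 2 * linkDisagreement (fun j i => γ ≤ A i j) x
      ≤ ∑ i, ∑ j, ∑ l, A i j * A i l * ‖x j - x l‖ ^ 2 := by
  rw [linkDisagreement, Finset.mul_sum]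
  refine Finset.sum_le_sum fun i _ => ?_
  have hterm (j l : ι) : 0 ≤ A i j * A i l * ‖x j - x l‖ ^ 2 :=
    mul_nonneg (mul_nonneg (hA i j) (hA i l)) (sq_nonneg _)
  calc γ ^ 2 * ∑ l, (if γ ≤ A i l then ‖x i - x l‖ ^ 2 else 0)
      ≤ ∑ l, A i i * A i l * ‖x i - x l‖ ^ 2 := by
        rw [Finset.mul_sum]
        refine Finset.sum_le_sum fun l _ => ?_
        split_ifs with hl
        · rw [sq γ]
          gcongr
          · exact hA i i
          · exact hdiag i
        · simpa using hterm i l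
    _ ≤ ∑ j, ∑ l, A i j * A i l * ‖x j - x l‖ ^ 2 :=
        Finset.single_le_sum (f := fun j => ∑ l, A i j * A i l * ‖x j - x l‖ ^ 2)
          (fun j _ => Finset.sum_nonneg fun l _ => hterm j l) (Finset.mem_univ i)

section Normed

variable [NormedSpace ℝ E] [DecidableEq ι] {A : Matrix ι ι ℝ} {x : ι → E}

theorem sum_smul_mem_of_convex (hA : A ∈ Matrix.rowStochastic ℝ ι) {S : Set E} (hS : Convex ℝ S)
    (hx : ∀ i, x i ∈ S) (i : ι) : ∑ j, A i j • x j ∈ S :=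
  hS.sum_mem (fun _ _ => Matrix.nonneg_of_mem_rowStochastic hA)
    (Matrix.sum_row_of_mem_rowStochastic hA i) fun j _ => hx j

theorem norm_sum_smul_sub_sum_smul_le (hA : A ∈ Matrix.rowStochastic ℝ ι) {D : ℝ}
    (h : ∀ i j, ‖x i - x j‖ ≤ D) (i j : ι) : ‖∑ l, A i l • x l - ∑ l, A j l • x l‖ ≤ D := by
  have hi (l : ι) : ∑ l, A i l • x l ∈ Metric.closedBall (x l) D :=
    sum_smul_mem_of_convex hA (convex_closedBall _ _) (fun k => mem_closedBall_iff_norm.2 (h k l)) i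
  have hj : ∑ l, A j l • x l ∈ Metric.closedBall (∑ l, A i l • x l) D :=
    sum_smul_mem_of_convex hA (convex_closedBall _ _)
      (fun l => Metric.mem_closedBall_comm.1 (hi l)) j
  rwa [Metric.mem_closedBall_comm, mem_closedBall_iff_norm] at hj

theorem norm_sub_le_of_perturbed_averaging {x : ℕ → ι → E} {A : ℕ → Matrix ι ι ℝ} {b : ℕ → ℝ}
    (hA : ∀ k, A k ∈ Matrix.rowStochastic ℝ ι)
    (hstep : ∀ k i, ‖x (k + 1) i - ∑ j, A k i j • x k j‖ ≤ b k) {D : ℝ}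
    (hD : ∀ i j, ‖x 0 i - x 0 j‖ ≤ D) (k : ℕ) (i j : ι) :
    ‖x k i - x k j‖ ≤ D + 2 * ∑ l ∈ Finset.range k, b l := by
  induction k generalizing i j with
  | zero => simpa using hD i j
  | succ k ih =>
    rw [Finset.sum_range_succ]
    linarith [norm_sub_le_norm_sub_add (hstep k) i j,
      norm_sum_smul_sub_sum_smul_le (hA k) ih i j]

end Normed

variable [InnerProductSpace ℝ E]

theorem sum_mul_mul_norm_sub_sq (w : ι → ℝ) (x : ι → E) :
    ∑ i, ∑ j, w i * w j * ‖x i - x j‖ ^ 2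
      = 2 * (∑ i, w i) * (∑ i, w i * ‖x i‖ ^ 2) - 2 * ‖∑ i, w i • x i‖ ^ 2 := by
  have hcross : ‖∑ i, w i • x i‖ ^ 2 = ∑ i, ∑ j, w i * w j * inner ℝ (x i) (x j) := by
    rw [← real_inner_self_eq_norm_sq, sum_inner]
    simp only [inner_sum, real_inner_smul_left, real_inner_smul_right, mul_assoc]
    exact Finset.sum_congr rfl fun i _ => Finset.sum_congr rfl fun j _ => mul_left_comm _ _ _
  have hright : (∑ i, w i) * (∑ i, w i * ‖x i‖ ^ 2) = ∑ i, ∑ j, w i * w j * ‖x j‖ ^ 2 := by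
    simp only [Finset.sum_mul_sum, mul_assoc]
  have hleft : (∑ i, w i) * (∑ i, w i * ‖x i‖ ^ 2) = ∑ i, ∑ j, w i * w j * ‖x i‖ ^ 2 := by
    rw [hright, Finset.sum_comm]
    simp only [mul_comm (w _) (w _)]
  calc ∑ i, ∑ j, w i * w j * ‖x i - x j‖ ^ 2
      = ∑ i, ∑ j, w i * w j * ‖x i‖ ^ 2 + ∑ i, ∑ j, w i * w j * ‖x j‖ ^ 2
          - 2 * ∑ i, ∑ j, w i * w j * inner ℝ (x i) (x j) := by
        simp only [Finset.mul_sum, ← Finset.sum_add_distrib, ← Finset.sum_sub_distrib,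
          norm_sub_sq_real]
        congr! 2
        ring
    _ = _ := by rw [← hright, ← hleft, ← hcross]; ring

theorem disagreement_eq_sub (x : ι → E) :
    disagreement x = 2 * Fintype.card ι * (∑ i, ‖x i‖ ^ 2) - 2 * ‖∑ i, x i‖ ^ 2 := by
  simpa [disagreement] using sum_mul_mul_norm_sub_sq (fun _ => 1) x

variable [DecidableEq ι] {A : Matrix ι ι ℝ}

theorem disagreement_sum_smul_eq_sub (hA : A ∈ doublyStochastic ℝ ι) (x : ι → E) :
    disagreement (fun i => ∑ j, A i j • x j)
      = disagreement x - Fintype.card ι * ∑ i, ∑ j, ∑ l, A i j * A i l * ‖x j - x l‖ ^ 2 := by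
  obtain ⟨-, hrow, hcol⟩ := mem_doublyStochastic_iff_sum.1 hA
  have hsum : ∑ i, ∑ j, A i j • x j = ∑ i, x i := by
    rw [Finset.sum_comm]
    simp only [← Finset.sum_smul, hcol, one_smul]
  have hnorm (i : ι) : ‖∑ j, A i j • x j‖ ^ 2 = ∑ j, A i j * ‖x j‖ ^ 2
      - (1 / 2) * ∑ j, ∑ l, A i j * A i l * ‖x j - x l‖ ^ 2 := by
    rw [sum_mul_mul_norm_sub_sq, hrow]; ring
  have hsq : ∑ i, ‖∑ j, A i j • x j‖ ^ 2
      = ∑ i, ‖x i‖ ^ 2 - (1 / 2) * ∑ i, ∑ j, ∑ l, A i j * A i l * ‖x j - x l‖ ^ 2 := by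
    simp only [hnorm, Finset.sum_sub_distrib, ← Finset.mul_sum]
    rw [Finset.sum_comm]
    simp only [← Finset.sum_mul, hcol, one_mul]
  rw [disagreement_eq_sub, disagreement_eq_sub, hsum, hsq]
  ring

theorem disagreement_sum_smul_le_self (hA : A ∈ doublyStochastic ℝ ι) (x : ι → E) :
    disagreement (fun i => ∑ j, A i j • x j) ≤ disagreement x := by
  have hA0 (i j : ι) : 0 ≤ A i j := nonneg_of_mem_doublyStochastic hA
  rw [disagreement_sum_smul_eq_sub hA, sub_le_self_iff]
  exact mul_nonneg (Nat.cast_nonneg _) <| Finset.sum_nonneg fun i _ => Finset.sum_nonneg fun j _ =>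
    Finset.sum_nonneg fun l _ => mul_nonneg (mul_nonneg (hA0 i j) (hA0 i l)) (sq_nonneg _)

theorem disagreement_sum_smul_le (hA : A ∈ doublyStochastic ℝ ι) {γ : ℝ} (hγ : 0 ≤ γ)
    (hdiag : ∀ i, γ ≤ A i i) (x : ι → E) :
    disagreement (fun i => ∑ j, A i j • x j)
      ≤ disagreement x
        - Fintype.card ι * γ ^ 2 * linkDisagreement (fun j i => γ ≤ A i j) x := by
  rw [disagreement_sum_smul_eq_sub hA, mul_assoc]
  exact sub_le_sub_left (mul_le_mul_of_nonneg_left (mul_linkDisagreement_le_sum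
    (A := A) (fun _ _ => nonneg_of_mem_doublyStochastic hA) hγ hdiag x) (Nat.cast_nonneg _)) _

end Averaging

section RealSequences

theorem tendsto_prod_one_sub_zero {q : ℕ → ℝ} (hq0 : ∀ k, 0 ≤ q k) (hq1 : ∀ k, q k ≤ 1)
    (hq : ¬Summable q) : Tendsto (fun n => ∏ k ∈ Finset.range n, (1 - q k)) atTop (𝓝 0) := by
  have hsum : Tendsto (fun n => ∑ k ∈ Finset.range n, q k) atTop atTop :=
    (not_summable_iff_tendsto_nat_atTop_of_nonneg hq0).1 hq
  refine squeeze_zero (fun n => Finset.prod_nonneg fun k _ => sub_nonneg.2 (hq1 k)) (fun n => ?_)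
    (Real.tendsto_exp_neg_atTop_nhds_zero.comp hsum)
  calc ∏ k ∈ Finset.range n, (1 - q k) ≤ ∏ k ∈ Finset.range n, Real.exp (-q k) :=
        Finset.prod_le_prod (fun k _ => sub_nonneg.2 (hq1 k))
          fun k _ => Real.one_sub_le_exp_neg (q k)
    _ = Real.exp (-∑ k ∈ Finset.range n, q k) := by
        rw [← Real.exp_sum, Finset.sum_neg_distrib]

theorem eventually_lt_of_le_one_sub_mul {u q : ℕ → ℝ} (hq0 : ∀ k, 0 ≤ q k) (hq1 : ∀ k, q k ≤ 1)
    (hq : ¬Summable q) (hu : ∀ k, u (k + 1) ≤ (1 - q k) * u k) {ε : ℝ} (hε : 0 < ε) :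
    ∀ᶠ k in atTop, u k < ε := by
  have hle (n : ℕ) : u n ≤ u 0 * ∏ k ∈ Finset.range n, (1 - q k) := by
    induction n with
    | zero => simp
    | succ n ih =>
      calc u (n + 1) ≤ (1 - q n) * u n := hu n
        _ ≤ (1 - q n) * (u 0 * ∏ k ∈ Finset.range n, (1 - q k)) :=
          mul_le_mul_of_nonneg_left ih (sub_nonneg.2 (hq1 n))
        _ = u 0 * ∏ k ∈ Finset.range (n + 1), (1 - q k) := by rw [Finset.prod_range_succ]; ring
  have hlim := (tendsto_prod_one_sub_zero hq0 hq1 hq).const_mul (u 0)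
  rw [mul_zero] at hlim
  exact (hlim.eventually (gt_mem_nhds hε)).mono fun n hn => (hle n).trans_lt hn

theorem tendsto_zero_of_le_one_sub_mul_add {u q b : ℕ → ℝ} (hu0 : ∀ k, 0 ≤ u k)
    (hq0 : ∀ k, 0 ≤ q k) (hq1 : ∀ k, q k ≤ 1) (hq : ¬Summable q) (hb : Tendsto b atTop (𝓝 0))
    (hu : ∀ k, u (k + 1) ≤ (1 - q k) * u k + q k * b k) : Tendsto u atTop (𝓝 0) := by
  refine tendsto_order.2 ⟨fun a ha => .of_forall fun k => ha.trans_le (hu0 k), fun ε hε => ?_⟩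
  obtain ⟨N, hN⟩ := eventually_atTop.1 (hb.eventually (gt_mem_nhds (half_pos hε)))
  -- Once `b ≤ ε / 2`, the excess `u - ε / 2` obeys the unperturbed recursion.
  have hexcess (k : ℕ) :
      u (k + 1 + N) - ε / 2 ≤ (1 - q (k + N)) * (u (k + N) - ε / 2) := by
    have hbk := mul_le_mul_of_nonneg_left (hN (k + N) (Nat.le_add_left N k)).le (hq0 (k + N))
    rw [Nat.add_right_comm]
    linarith [hu (k + N)]
  have hev := eventually_lt_of_le_one_sub_mul (u := fun k => u (k + N) - ε / 2)
    (fun k => hq0 (k + N)) (fun k => hq1 (k + N)) (fun h => hq ((summable_nat_add_iff N).1 h))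
    hexcess (half_pos hε)
  rw [← map_add_atTop_eq_nat N]
  exact eventually_map.2 (hev.mono fun k hk => by linarith)

theorem perturbed_contraction_le {q u c b : ℝ} (hq0 : 0 < q) (hq1 : q ≤ 1) (hu : 0 ≤ u)
    (hc : 0 ≤ c) :
    (1 + q / 2) * ((1 - q) * u) + (1 + (q / 2)⁻¹) * (c * b ^ 2)
      ≤ (1 - q / 2) * u + q / 2 * (6 * c * (b / q) ^ 2) := by
  have hfirst : (1 + q / 2) * ((1 - q) * u) ≤ (1 - q / 2) * u := by
    nlinarith [mul_nonneg (sq_nonneg q) hu]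
  have hsecond : (1 + (q / 2)⁻¹) * (c * b ^ 2) ≤ 3 / q * (c * b ^ 2) := by
    refine mul_le_mul_of_nonneg_right ?_ (by positivity)
    rw [inv_div, ← sub_nonneg]
    calc (0 : ℝ) ≤ (1 - q) / q := div_nonneg (sub_nonneg.2 hq1) hq0.le
      _ = 3 / q - (1 + 2 / q) := by field_simp; ring
  calc _ ≤ (1 - q / 2) * u + 3 / q * (c * b ^ 2) := add_le_add hfirst hsecond
    _ = _ := by field_simp; ring

end RealSequences

section Independence

variable {Ω Ω' β : Type*} [MeasurableSpace Ω] [MeasurableSpace Ω'] [MeasurableSpace β]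
  {P : Measure Ω} {x : Ω → β} {ξ : Ω → Ω'}

theorem integral_indicator_fst_eq_integral_measureReal_mul [IsFiniteMeasure P]
    (hx : Measurable x) (hξ : Measurable ξ) (hind : IndepFun x ξ P) {T : Set (β × Ω')}
    (hT : MeasurableSet T) {g : β → ℝ} (hg : Measurable g) (hint : Integrable (g ∘ x) P) :
    ∫ ω, T.indicator (fun z => g z.1) (x ω, ξ ω) ∂P
      = ∫ ω, P.real {ω' | (x ω, ξ ω') ∈ T} * g (x ω) ∂P := by
  have hgT : Measurable (T.indicator fun z => g z.1) := (hg.comp measurable_fst).indicator hT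
  have hlaw := (indepFun_iff_map_prod_eq_prod_map_map hx.aemeasurable hξ.aemeasurable).1 hind
  have hintT : Integrable (T.indicator fun z => g z.1) ((P.map x).prod (P.map ξ)) :=
    (((integrable_map_measure hg.aestronglyMeasurable hx.aemeasurable).2 hint).comp_fst _).indicator
      hT
  have hinner (a : β) : ∫ b, T.indicator (fun z => g z.1) (a, b) ∂P.map ξ
      = (P.map ξ).real (Prod.mk a ⁻¹' T) * g a :=
    integral_indicator_const (g a) (measurable_prodMk_left hT)
  have hsection : Measurable fun a => (P.map ξ).real (Prod.mk a ⁻¹' T) :=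
    (measurable_measure_prodMk_left hT).ennreal_toReal
  calc ∫ ω, T.indicator (fun z => g z.1) (x ω, ξ ω) ∂P
      = ∫ z, T.indicator (fun z => g z.1) z ∂(P.map x).prod (P.map ξ) := by
        rw [← hlaw, integral_map (hx.prodMk hξ).aemeasurable hgT.aestronglyMeasurable]
    _ = ∫ a, (P.map ξ).real (Prod.mk a ⁻¹' T) * g a ∂P.map x := by
        simp only [integral_prod _ hintT, hinner]
    _ = ∫ ω, (P.map ξ).real (Prod.mk (x ω) ⁻¹' T) * g (x ω) ∂P :=
        integral_map hx.aemeasurable (hsection.mul hg).aestronglyMeasurable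
    _ = ∫ ω, P.real {ω' | (x ω, ξ ω') ∈ T} * g (x ω) ∂P := by
        simp only [map_measureReal_apply hξ (measurable_prodMk_left hT)]; rfl

theorem mul_integral_le_integral_indicator_fst [IsFiniteMeasure P]
    (hx : Measurable x) (hξ : Measurable ξ) (hind : IndepFun x ξ P) {T : Set (β × Ω')}
    (hT : MeasurableSet T) {g : β → ℝ} (hg : Measurable g) (hg0 : 0 ≤ g)
    (hint : Integrable (g ∘ x) P) {p : ℝ} (hp : ∀ᵐ ω ∂P, p ≤ P.real {ω' | (x ω, ξ ω') ∈ T}) :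
    p * ∫ ω, g (x ω) ∂P ≤ ∫ ω, T.indicator (fun z => g z.1) (x ω, ξ ω) ∂P := by
  rw [integral_indicator_fst_eq_integral_measureReal_mul hx hξ hind hT hg hint,
    ← integral_const_mul]
  have hsection : Measurable fun ω => P.real {ω' | (x ω, ξ ω') ∈ T} := by
    have := ((measurable_measure_prodMk_left (ν := P.map ξ) hT).comp hx).ennreal_toReal
    simp only [Function.comp_def, Measure.map_apply hξ (measurable_prodMk_left hT)] at this
    exact this
  refine integral_mono_ae (hint.const_mul p) ?_ ?_
  · refine (hint.const_mul (P.real Set.univ)).mono'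
      (hsection.mul (hg.comp hx)).aestronglyMeasurable (.of_forall fun ω => ?_)
    rw [Real.norm_of_nonneg (mul_nonneg measureReal_nonneg (hg0 _))]
    exact mul_le_mul_of_nonneg_right (measureReal_mono (Set.subset_univ _)) (hg0 _)
  · filter_upwards [hp] with ω hω
    exact mul_le_mul_of_nonneg_right hω (hg0 _)

end Independence

section ExpectedContraction

variable {ι E Ω Ω' : Type*} [Fintype ι] [NormedAddCommGroup E] [MeasurableSpace E] [BorelSpace E]
  [SecondCountableTopology E] [MeasurableSpace Ω] [MeasurableSpace Ω'] {P : Measure Ω}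
  {x : Ω → ι → E} {ξ : Ω → Ω'} {ψ : (ι → E) → Ω' → Matrix ι ι ℝ} {γ : ℝ}

theorem integrable_norm_sub_sq_of_disagreement (hx : Measurable x)
    (hint : Integrable (fun ω => disagreement (x ω)) P) (i j : ι) :
    Integrable (fun ω => ‖x ω i - x ω j‖ ^ 2) P := by
  have hxi := measurable_pi_iff.1 hx
  refine hint.mono' (((hxi i).sub (hxi j)).norm.pow_const 2).aestronglyMeasurable
    (.of_forall fun ω => ?_)
  rw [Real.norm_of_nonneg (sq_nonneg _)]
  exact norm_sub_sq_le_disagreement (x ω) i j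

theorem integrable_linkDisagreement (hx : Measurable x) {r : Ω → ι → ι → Prop}
    (hr : ∀ i j, MeasurableSet {ω | r ω j i}) (hint : Integrable (fun ω => disagreement (x ω)) P) :
    Integrable (fun ω => linkDisagreement (r ω) (x ω)) P := by
  classical
  exact integrable_finsetSum _ fun i _ => integrable_finsetSum _ fun j _ =>
    (integrable_norm_sub_sq_of_disagreement hx hint i j).indicator (hr i j)

theorem mul_integral_linkDisagreement_le [IsFiniteMeasure P] (hx : Measurable x)
    (hξ : Measurable ξ) (hind : IndepFun x ξ P)
    (hψ : ∀ i j, Measurable fun z : (ι → E) × Ω' => ψ z.1 z.2 i j)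
    (hint : Integrable (fun ω => disagreement (x ω)) P) {r : ι → ι → Prop} {p : ℝ}
    (hp : ∀ i j, r j i → ∀ᵐ ω ∂P, p ≤ P.real {ω' | γ ≤ ψ (x ω) (ξ ω') i j}) :
    p * ∫ ω, linkDisagreement r (x ω) ∂P
      ≤ ∫ ω, linkDisagreement (fun j i => γ ≤ ψ (x ω) (ξ ω) i j) (x ω) ∂P := by
  classical
  have hT (i j : ι) : MeasurableSet {z : (ι → E) × Ω' | γ ≤ ψ z.1 z.2 i j} :=
    measurableSet_le measurable_const (hψ i j)
  have hactive (i j : ι) : Integrable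
      (fun ω => if γ ≤ ψ (x ω) (ξ ω) i j then ‖x ω i - x ω j‖ ^ 2 else 0) P :=
    (integrable_norm_sub_sq_of_disagreement hx hint i j).indicator (hx.prodMk hξ (hT i j))
  have hlink (i j : ι) : Integrable
      (fun ω => if r j i then ‖x ω i - x ω j‖ ^ 2 else 0) P :=
    (integrable_norm_sub_sq_of_disagreement hx hint i j).indicator (.const (r j i))
  simp only [linkDisagreement]
  rw [integral_finsetSum _ fun i _ => integrable_finsetSum _ fun j _ => hlink i j,
    integral_finsetSum _ fun i _ => integrable_finsetSum _ fun j _ => hactive i j, Finset.mul_sum]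
  refine Finset.sum_le_sum fun i _ => ?_
  rw [integral_finsetSum _ fun j _ => hlink i j, integral_finsetSum _ fun j _ => hactive i j,
    Finset.mul_sum]
  refine Finset.sum_le_sum fun j _ => ?_
  by_cases hij : r j i
  · simpa only [hij, if_true, Set.indicator, Set.mem_ofPred_eq] using
      mul_integral_le_integral_indicator_fst hx hξ hind (hT i j)
        (g := fun y => ‖y i - y j‖ ^ 2) (by fun_prop) (fun _ => sq_nonneg _)
        (integrable_norm_sub_sq_of_disagreement hx hint i j) (hp i j hij)
  · simp only [hij, if_false, integral_zero, mul_zero]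
    exact integral_nonneg fun ω => by dsimp only; split_ifs <;> positivity

theorem measurable_sum_smul [NormedSpace ℝ E] (hx : Measurable x) (hξ : Measurable ξ)
    (hψ : ∀ i j, Measurable fun z : (ι → E) × Ω' => ψ z.1 z.2 i j) (i : ι) :
    Measurable fun ω => ∑ j, ψ (x ω) (ξ ω) i j • x ω j :=
  Finset.measurable_fun_sum _ fun j _ =>
    ((hψ i j).comp (hx.prodMk hξ)).smul (measurable_pi_iff.1 hx j)

variable [DecidableEq ι] [InnerProductSpace ℝ E]

theorem integrable_disagreement_sum_smul (hx : Measurable x) (hξ : Measurable ξ)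
    (hψ : ∀ i j, Measurable fun z : (ι → E) × Ω' => ψ z.1 z.2 i j)
    (hint : Integrable (fun ω => disagreement (x ω)) P)
    (hA : ∀ᵐ ω ∂P, ψ (x ω) (ξ ω) ∈ doublyStochastic ℝ ι) :
    Integrable (fun ω => disagreement fun i => ∑ j, ψ (x ω) (ξ ω) i j • x ω j) P := by
  refine hint.mono' (measurable_disagreement.comp
    (measurable_pi_iff.2 (measurable_sum_smul hx hξ hψ))).aestronglyMeasurable ?_
  filter_upwards [hA] with ω hω
  rw [Real.norm_of_nonneg (disagreement_nonneg _)]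
  exact disagreement_sum_smul_le_self hω (x ω)

theorem integral_disagreement_sum_smul_le [IsFiniteMeasure P] (hx : Measurable x)
    (hξ : Measurable ξ) (hind : IndepFun x ξ P)
    (hψ : ∀ i j, Measurable fun z : (ι → E) × Ω' => ψ z.1 z.2 i j)
    (hint : Integrable (fun ω => disagreement (x ω)) P)
    (hA : ∀ᵐ ω ∂P, ψ (x ω) (ξ ω) ∈ doublyStochastic ℝ ι) (hγ : 0 ≤ γ)
    (hdiag : ∀ᵐ ω ∂P, ∀ i, γ ≤ ψ (x ω) (ξ ω) i i) {r : ι → ι → Prop} {κ p : ℝ} (hp0 : 0 ≤ p)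
    (hκ : ∀ y : ι → E, κ * disagreement y ≤ linkDisagreement r y)
    (hp : ∀ i j, r j i → ∀ᵐ ω ∂P, p ≤ P.real {ω' | γ ≤ ψ (x ω) (ξ ω') i j}) :
    ∫ ω, disagreement (fun i => ∑ j, ψ (x ω) (ξ ω) i j • x ω j) ∂P
      ≤ (1 - Fintype.card ι * γ ^ 2 * κ * p) * ∫ ω, disagreement (x ω) ∂P := by
  set active : Ω → ℝ := fun ω => linkDisagreement (fun j i => γ ≤ ψ (x ω) (ξ ω) i j) (x ω)
  have hactive : Integrable active P :=
    integrable_linkDisagreement hx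
      (fun i j => measurableSet_le measurable_const ((hψ i j).comp (hx.prodMk hξ))) hint
  have hlink : κ * ∫ ω, disagreement (x ω) ∂P ≤ ∫ ω, linkDisagreement r (x ω) ∂P := by
    rw [← integral_const_mul]
    exact integral_mono (hint.const_mul κ)
      (integrable_linkDisagreement hx (fun i j => .const (r j i)) hint) fun ω => hκ (x ω)
  calc ∫ ω, disagreement (fun i => ∑ j, ψ (x ω) (ξ ω) i j • x ω j) ∂P
      ≤ ∫ ω, (disagreement (x ω) - Fintype.card ι * γ ^ 2 * active ω) ∂P := by
        refine integral_mono_ae (integrable_disagreement_sum_smul hx hξ hψ hint hA)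
          (hint.sub (hactive.const_mul _)) ?_
        filter_upwards [hA, hdiag] with ω hω hωdiag
        exact disagreement_sum_smul_le hω hγ hωdiag (x ω)
    _ = ∫ ω, disagreement (x ω) ∂P - Fintype.card ι * γ ^ 2 * ∫ ω, active ω ∂P := by
        rw [integral_sub hint (hactive.const_mul _), integral_const_mul]
    _ ≤ ∫ ω, disagreement (x ω) ∂P
          - Fintype.card ι * γ ^ 2 * (p * (κ * ∫ ω, disagreement (x ω) ∂P)) := by
        gcongr
        exact (mul_le_mul_of_nonneg_left hlink hp0).trans
          (mul_integral_linkDisagreement_le hx hξ hind hψ hint hp)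
    _ = _ := by ring

end ExpectedContraction

section PerturbedAveraging

variable {ι E Ω : Type*} [Fintype ι] [NormedAddCommGroup E] [MeasurableSpace Ω] {P : Measure Ω}
  {z v : Ω → ι → E}

theorem integrable_disagreement_of_norm_sub_le [IsFiniteMeasure P] [MeasurableSpace E]
    [BorelSpace E] [SecondCountableTopology E] {D : ℝ} (hz : Measurable z)
    (hD : ∀ᵐ ω ∂P, ∀ i j, ‖z ω i - z ω j‖ ≤ D) :
    Integrable (fun ω => disagreement (z ω)) P := by
  refine .of_bound (measurable_disagreement.comp hz).aestronglyMeasurable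
    ((Fintype.card ι) ^ 2 * D ^ 2) ?_
  filter_upwards [hD] with ω hω
  rw [Real.norm_of_nonneg (disagreement_nonneg _)]
  exact disagreement_le_of_norm_sub_le hω

theorem integrable_disagreement_of_perturbation [IsFiniteMeasure P] [MeasurableSpace E]
    [BorelSpace E] [SecondCountableTopology E] {b : ℝ} (hz : Measurable z)
    (hv : Integrable (fun ω => disagreement (v ω)) P)
    (hzv : ∀ᵐ ω ∂P, ∀ i, ‖z ω i - v ω i‖ ≤ b) :
    Integrable (fun ω => disagreement (z ω)) P := by
  refine ((hv.const_mul (1 + 1)).add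
    (integrable_const ((1 + 1⁻¹) * (4 * (Fintype.card ι) ^ 2 * b ^ 2)))).mono'
    (measurable_disagreement.comp hz).aestronglyMeasurable ?_
  filter_upwards [hzv] with ω hω
  rw [Real.norm_of_nonneg (disagreement_nonneg _)]
  exact disagreement_le_of_perturbation one_pos hω

theorem integral_disagreement_le_of_perturbation [IsProbabilityMeasure P] {b η : ℝ} (hη : 0 < η)
    (hz : Integrable (fun ω => disagreement (z ω)) P)
    (hv : Integrable (fun ω => disagreement (v ω)) P)
    (hzv : ∀ᵐ ω ∂P, ∀ i, ‖z ω i - v ω i‖ ≤ b) :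
    ∫ ω, disagreement (z ω) ∂P ≤ (1 + η) * ∫ ω, disagreement (v ω) ∂P
      + (1 + η⁻¹) * (4 * (Fintype.card ι) ^ 2 * b ^ 2) := by
  calc ∫ ω, disagreement (z ω) ∂P
      ≤ ∫ ω, ((1 + η) * disagreement (v ω)
          + (1 + η⁻¹) * (4 * (Fintype.card ι) ^ 2 * b ^ 2)) ∂P := by
        refine integral_mono_ae hz ((hv.const_mul _).add (integrable_const _)) ?_
        filter_upwards [hzv] with ω hω using disagreement_le_of_perturbation hη hω
    _ = _ := by
        rw [integral_add (hv.const_mul _) (integrable_const _), integral_const_mul,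
          integral_const, probReal_univ, one_smul]

variable {Ω' : Type*} [DecidableEq ι] [InnerProductSpace ℝ E] [MeasurableSpace E] [BorelSpace E]
  [SecondCountableTopology E] [MeasurableSpace Ω'] {x : ℕ → Ω → ι → E} {ξ : ℕ → Ω → Ω'}
  {ψ : (ι → E) → Ω' → Matrix ι ι ℝ} {b : ℕ → ℝ}

theorem integrable_disagreement_of_perturbed_averaging [IsFiniteMeasure P]
    (hx : ∀ k, Measurable (x k))
    (hξ : ∀ k, Measurable (ξ k)) (hψ : ∀ i j, Measurable fun z : (ι → E) × Ω' => ψ z.1 z.2 i j)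
    (hint : Integrable (fun ω => disagreement (x 0 ω)) P)
    (hA : ∀ᵐ ω ∂P, ∀ k, ψ (x k ω) (ξ k ω) ∈ doublyStochastic ℝ ι)
    (hstep : ∀ᵐ ω ∂P, ∀ k i, ‖x (k + 1) ω i - ∑ j, ψ (x k ω) (ξ k ω) i j • x k ω j‖ ≤ b k)
    (k : ℕ) : Integrable (fun ω => disagreement (x k ω)) P := by
  induction k with
  | zero => exact hint
  | succ k ih =>
    exact integrable_disagreement_of_perturbation (hx (k + 1))
      (integrable_disagreement_sum_smul (hx k) (hξ k) hψ ih (hA.mono fun _ h => h k))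
      (hstep.mono fun _ h => h k)

theorem tendsto_integral_disagreement_of_perturbed_averaging [IsProbabilityMeasure P] [Nonempty ι]
    (hx : ∀ k, Measurable (x k)) (hξ : ∀ k, Measurable (ξ k))
    (hind : ∀ k, IndepFun (x k) (ξ k) P)
    (hψ : ∀ i j, Measurable fun z : (ι → E) × Ω' => ψ z.1 z.2 i j)
    (hint : Integrable (fun ω => disagreement (x 0 ω)) P)
    (hA : ∀ᵐ ω ∂P, ∀ k, ψ (x k ω) (ξ k ω) ∈ doublyStochastic ℝ ι) {γ : ℝ} (hγ : 0 < γ)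
    (hdiag : ∀ᵐ ω ∂P, ∀ k i, γ ≤ ψ (x k ω) (ξ k ω) i i)
    (hstep : ∀ᵐ ω ∂P, ∀ k i, ‖x (k + 1) ω i - ∑ j, ψ (x k ω) (ξ k ω) i j • x k ω j‖ ≤ b k)
    {r : ι → ι → Prop} (hr : ∀ i j, Relation.EqvGen r i j) {p : ℕ → ℝ} (hp0 : ∀ k, 0 < p k)
    (hp1 : ∀ k, p k ≤ 1) (hp : ¬Summable p)
    (hlink : ∀ k i j, r j i → ∀ᵐ ω ∂P, p k ≤ P.real {ω' | γ ≤ ψ (x k ω) (ξ k ω') i j})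
    (hb : Tendsto (fun k => b k / p k) atTop (𝓝 0)) :
    Tendsto (fun k => ∫ ω, disagreement (x k ω) ∂P) atTop (𝓝 0) := by
  obtain ⟨κ, hκ0, hκ⟩ := exists_pos_mul_disagreement_le_linkDisagreement E hr
  obtain ⟨θ, hθ0, hθ1, hθ⟩ : ∃ θ : ℝ, 0 < θ ∧ θ ≤ 1 ∧ θ ≤ Fintype.card ι * γ ^ 2 * κ :=
    ⟨min 1 (Fintype.card ι * γ ^ 2 * κ), by positivity, min_le_left _ _, min_le_right _ _⟩
  set U : ℕ → ℝ := fun k => ∫ ω, disagreement (x k ω) ∂P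
  have hU0 (k : ℕ) : 0 ≤ U k := integral_nonneg fun _ => disagreement_nonneg _
  have hq0 (k : ℕ) : 0 < θ * p k := mul_pos hθ0 (hp0 k)
  have hq1 (k : ℕ) : θ * p k ≤ 1 := mul_le_one₀ hθ1 (hp0 k).le (hp1 k)
  have hintx := integrable_disagreement_of_perturbed_averaging hx hξ hψ hint hA hstep
  have hcontract (k : ℕ) :
      ∫ ω, disagreement (fun i => ∑ j, ψ (x k ω) (ξ k ω) i j • x k ω j) ∂P
        ≤ (1 - θ * p k) * U k :=
    (integral_disagreement_sum_smul_le (hx k) (hξ k) (hind k) hψ (hintx k)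
      (hA.mono fun _ h => h k) hγ.le (hdiag.mono fun _ h => h k) (hp0 k).le hκ (hlink k)).trans
      (mul_le_mul_of_nonneg_right
        (sub_le_sub_left (mul_le_mul_of_nonneg_right hθ (hp0 k).le) 1) (hU0 k))
  have hrec (k : ℕ) : U (k + 1) ≤ (1 - θ * p k / 2) * U k
      + θ * p k / 2 * (6 * (4 * (Fintype.card ι) ^ 2) * (b k / (θ * p k)) ^ 2) := by
    refine (integral_disagreement_le_of_perturbation (half_pos (hq0 k)) (hintx (k + 1))
      (integrable_disagreement_sum_smul (hx k) (hξ k) hψ (hintx k) (hA.mono fun _ h => h k))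
      (hstep.mono fun _ h => h k)).trans (le_trans ?_
        (perturbed_contraction_le (hq0 k) (hq1 k) (hU0 k) (by positivity)))
    have := hq0 k
    gcongr
    exact hcontract k
  have hbq : Tendsto (fun k => b k / (θ * p k)) atTop (𝓝 0) := by
    simpa only [div_div, mul_comm θ, zero_div] using hb.div_const θ
  refine tendsto_zero_of_le_one_sub_mul_add hU0 (fun k => (half_pos (hq0 k)).le)
    (fun k => by linarith [hq1 k, hq0 k]) ?_ ?_ hrec
  · simpa only [mul_div_right_comm] using mt (summable_mul_left_iff (half_pos hθ0).ne').1 hp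
  · simpa using (hbq.pow 2).const_mul (6 * (4 * (Fintype.card ι : ℝ) ^ 2))

end PerturbedAveraging

section PowerBounds

theorem mul_rpow_neg_le_rpow_sub_rpow {s t : ℝ} (hs0 : 0 ≤ s) (hs1 : s ≤ 1) (ht : 1 ≤ t) :
    (1 - s) * t ^ (-s) ≤ t ^ (1 - s) - (t - 1) ^ (1 - s) := by
  have ht0 : 0 < t := one_pos.trans_le ht
  have hinv : -1 ≤ -t⁻¹ := neg_le_neg (inv_le_one_of_one_le₀ ht)
  have hsplit : t ^ (1 - s) = t ^ (-s) * t := by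
    rw [sub_eq_neg_add, Real.rpow_add_one ht0.ne']
  have hbernoulli : (t - 1) ^ (1 - s) ≤ t ^ (1 - s) * (1 + (1 - s) * -t⁻¹) := by
    calc (t - 1) ^ (1 - s) = t ^ (1 - s) * (1 + -t⁻¹) ^ (1 - s) := by
          rw [← Real.mul_rpow ht0.le (by linarith)]
          congr 1
          field_simp
          ring
      _ ≤ t ^ (1 - s) * (1 + (1 - s) * -t⁻¹) := by
          gcongr
          exact rpow_one_add_le_one_add_mul_self hinv (sub_nonneg.2 hs1) (by linarith)
  have hcancel : t ^ (1 - s) * (1 + (1 - s) * -t⁻¹) = t ^ (1 - s) - (1 - s) * t ^ (-s) := by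
    rw [hsplit]
    field_simp
    ring
  linarith

theorem sum_range_rpow_neg_le {s : ℝ} (hs0 : 0 ≤ s) (hs1 : s < 1) (n : ℕ) :
    ∑ k ∈ Finset.range n, ((k : ℝ) + 1) ^ (-s) ≤ (1 - s)⁻¹ * (n : ℝ) ^ (1 - s) := by
  rw [le_inv_mul_iff₀ (sub_pos.2 hs1), Finset.mul_sum]
  calc ∑ k ∈ Finset.range n, (1 - s) * ((k : ℝ) + 1) ^ (-s)
      ≤ ∑ k ∈ Finset.range n, (((k + 1 : ℕ) : ℝ) ^ (1 - s) - (k : ℝ) ^ (1 - s)) := by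
        refine Finset.sum_le_sum fun k _ => ?_
        simpa using mul_rpow_neg_le_rpow_sub_rpow hs0 hs1.le (t := (k : ℝ) + 1) (by simp)
    _ = (n : ℝ) ^ (1 - s) := by
        rw [Finset.sum_range_sub fun k : ℕ => (k : ℝ) ^ (1 - s), Nat.cast_zero,
          Real.zero_rpow (sub_pos.2 hs1).ne', sub_zero]

theorem exists_sum_range_le_rpow {b : ℕ → ℝ} {s : ℝ} (hs0 : 0 ≤ s) (hs1 : s < 1)
    (hb : b =O[atTop] fun k : ℕ => ((k : ℝ) + 1) ^ (-s)) :
    ∃ B : ℝ, 0 < B ∧ ∀ n : ℕ, ∑ k ∈ Finset.range n, b k ≤ B * ((n : ℝ) + 1) ^ (1 - s) := by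
  have hpow (k : ℕ) : 0 < ((k : ℝ) + 1) ^ (-s) := by positivity
  obtain ⟨M, hM0, hM⟩ := Asymptotics.bound_of_isBigO_nat_atTop hb
  have h1s : 0 < 1 - s := sub_pos.2 hs1
  refine ⟨M * (1 - s)⁻¹, mul_pos hM0 (inv_pos.2 h1s), fun n => ?_⟩
  calc ∑ k ∈ Finset.range n, b k ≤ ∑ k ∈ Finset.range n, M * ((k : ℝ) + 1) ^ (-s) := by
        gcongr with k
        simpa only [Real.norm_of_nonneg (hpow k).le] using
          (Real.le_norm_self _).trans (hM (hpow k).ne')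
    _ ≤ M * ((1 - s)⁻¹ * (n : ℝ) ^ (1 - s)) := by
        rw [← Finset.mul_sum]
        exact mul_le_mul_of_nonneg_left (sum_range_rpow_neg_le hs0 hs1 n) hM0.le
    _ ≤ M * (1 - s)⁻¹ * ((n : ℝ) + 1) ^ (1 - s) := by
        rw [← mul_assoc]
        gcongr
        exact le_add_of_nonneg_right zero_le_one

theorem not_summable_const_mul_rpow_neg {c e : ℝ} (hc : c ≠ 0) (he : e ≤ 1) :
    ¬Summable fun k : ℕ => c * ((k : ℝ) + 1) ^ (-e) := by
  rw [summable_mul_left_iff hc]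
  have hshift := summable_nat_add_iff (f := fun k : ℕ => (k : ℝ) ^ (-e)) 1
  push_cast at hshift
  rw [hshift, Real.summable_nat_rpow]
  linarith

theorem tendsto_div_const_mul_rpow_neg {b : ℕ → ℝ} {c e s : ℝ} (hc : c ≠ 0) (he : e < s)
    (hb : b =O[atTop] fun k : ℕ => ((k : ℝ) + 1) ^ (-s)) :
    Tendsto (fun k : ℕ => b k / (c * ((k : ℝ) + 1) ^ (-e))) atTop (𝓝 0) := by
  have hlim : Tendsto (fun k : ℕ => c⁻¹ * ((k : ℝ) + 1) ^ (-(s - e))) atTop (𝓝 0) := by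
    simpa using ((tendsto_rpow_neg_atTop (sub_pos.2 he)).comp
      (tendsto_atTop_add_const_right _ 1 tendsto_natCast_atTop_atTop)).const_mul c⁻¹
  refine (hb.mul (Asymptotics.isBigO_refl (fun k : ℕ => (c * ((k : ℝ) + 1) ^ (-e))⁻¹)
    atTop)).trans_tendsto (hlim.congr fun k => ?_)
  have hk : (0 : ℝ) < (k : ℝ) + 1 := by positivity
  rw [show -(s - e) = -s - -e by ring, Real.rpow_sub hk]
  field_simp

theorem isBigO_rpow_neg_of_le {b : ℕ → ℝ} {s t : ℝ} (hts : t ≤ s)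
    (hb : b =O[atTop] fun k : ℕ => ((k : ℝ) + 1) ^ (-s)) :
    b =O[atTop] fun k : ℕ => ((k : ℝ) + 1) ^ (-t) := by
  refine hb.trans (.of_bound' (.of_forall fun k => ?_))
  rw [Real.norm_of_nonneg (by positivity), Real.norm_of_nonneg (by positivity)]
  exact Real.rpow_le_rpow_of_exponent_le (by simp) (neg_le_neg hts)

theorem exists_le_linkBound {δ K C B τ : ℝ} (hδ : 0 < δ) (hK : 0 < K) (hC : 0 ≤ C) (hB : 0 < B)
    (hτ : 0 ≤ τ) :
    ∃ c : ℝ, 0 < c ∧ c ≤ 1 ∧ ∀ u t : ℝ, 1 ≤ u → 0 ≤ t → t ≤ B * u ^ τ →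
      c * u ^ (-(C * τ)) ≤ linkBound δ K C t := by
  refine ⟨min 1 (min δ (K / B ^ C)), by positivity, min_le_left _ _, fun u t hu ht htB => ?_⟩
  have hu0 : 0 < u := one_pos.trans_le hu
  have hδu : min 1 (min δ (K / B ^ C)) * u ^ (-(C * τ)) ≤ δ :=
    (mul_le_of_le_one_right (by positivity)
      (Real.rpow_le_one_of_one_le_of_nonpos hu (neg_nonpos.2 (by positivity)))).trans
      ((min_le_right _ _).trans (min_le_left _ _))
  unfold linkBound
  split_ifs with ht0
  · exact hδu
  · have htpos : 0 < t := lt_of_le_of_ne' ht ht0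
    refine le_min hδu ?_
    calc min 1 (min δ (K / B ^ C)) * u ^ (-(C * τ)) ≤ K / B ^ C * u ^ (-(C * τ)) := by
          gcongr
          exact (min_le_right _ _).trans (min_le_right _ _)
      _ = K / (B * u ^ τ) ^ C := by
          rw [Real.mul_rpow hB.le (by positivity), ← Real.rpow_mul hu0.le, Real.rpow_neg hu0.le,
            mul_comm τ]
          field_simp
      _ ≤ K / t ^ C :=
        div_le_div_of_nonneg_left hK.le (Real.rpow_pos_of_pos htpos C) (Real.rpow_le_rpow ht htB hC)

theorem LimitingStepsizes.isBigO {α : ℕ → ℝ} (hα : LimitingStepsizes α) :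
    α =O[atTop] fun k : ℕ => ((k : ℝ) + 1) ^ (-1 : ℝ) := by
  have hlim : Tendsto (fun k : ℕ => (k : ℝ) * α k) atTop (𝓝 0) := by simpa using hα 0 one_pos
  have hcast : (fun k : ℕ => (k : ℝ) + 1) =O[atTop] fun k : ℕ => (k : ℝ) := by
    refine .of_bound 2 (eventually_ge_atTop 1 |>.mono fun k hk => ?_)
    have hk1 : (1 : ℝ) ≤ k := by exact_mod_cast hk
    rw [Real.norm_of_nonneg (by positivity), Real.norm_of_nonneg (by positivity)]
    linarith
  refine ((hcast.mul (Asymptotics.isBigO_refl α atTop)).trans (hlim.isBigO_one ℝ)).mul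
    (Asymptotics.isBigO_refl (fun k : ℕ => ((k : ℝ) + 1) ^ (-1 : ℝ)) atTop) |>.congr
    (fun k => ?_) fun k => one_mul _
  rw [Real.rpow_neg_one]
  field_simp

end PowerBounds

section StateDependentLinks

variable {ι E : Type*} [Fintype ι] [NormedAddCommGroup E] {b : ℕ → ℝ} {s : ℝ}

theorem exists_norm_sub_le_rpow_of_perturbed_averaging [NormedSpace ℝ E] [DecidableEq ι]
    (hs0 : 0 ≤ s) (hs1 : s < 1) (hb : b =O[atTop] fun k : ℕ => ((k : ℝ) + 1) ^ (-s)) (D : ℝ) :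
    ∃ B : ℝ, 0 < B ∧ ∀ (x : ℕ → ι → E) (A : ℕ → Matrix ι ι ℝ),
      (∀ k, A k ∈ Matrix.rowStochastic ℝ ι) →
      (∀ k i, ‖x (k + 1) i - ∑ j, A k i j • x k j‖ ≤ b k) →
      (∀ i j, ‖x 0 i - x 0 j‖ ≤ D) →
      ∀ k i j, ‖x k i - x k j‖ ≤ B * ((k : ℝ) + 1) ^ (1 - s) := by
  obtain ⟨B, hB0, hB⟩ := exists_sum_range_le_rpow hs0 hs1 hb
  refine ⟨|D| + 2 * B, by positivity, fun x A hA hstep hD k i j => ?_⟩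
  have hk : 1 ≤ ((k : ℝ) + 1) ^ (1 - s) := Real.one_le_rpow (by simp) (sub_nonneg.2 hs1.le)
  calc ‖x k i - x k j‖ ≤ D + 2 * ∑ l ∈ Finset.range k, b l :=
        norm_sub_le_of_perturbed_averaging hA hstep hD k i j
    _ ≤ |D| * ((k : ℝ) + 1) ^ (1 - s) + 2 * (B * ((k : ℝ) + 1) ^ (1 - s)) := by
        gcongr
        · exact (le_abs_self D).trans (le_mul_of_one_le_right (abs_nonneg D) hk)
        · exact hB k
    _ = (|D| + 2 * B) * ((k : ℝ) + 1) ^ (1 - s) := by ring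

variable {Ω Ω' : Type*} [MeasurableSpace Ω] [MeasurableSpace Ω'] {P : Measure Ω} [DecidableEq ι]
  [InnerProductSpace ℝ E] [MeasurableSpace E] [BorelSpace E] [SecondCountableTopology E]
  {x : ℕ → Ω → ι → E} {ξ : ℕ → Ω → Ω'} {ψ : (ι → E) → Ω' → Matrix ι ι ℝ}

theorem tendsto_integral_disagreement_of_linkBound [IsProbabilityMeasure P] [Nonempty ι]
    (hx : ∀ k, Measurable (x k)) (hξ : ∀ k, Measurable (ξ k))
    (hind : ∀ k, IndepFun (x k) (ξ k) P)
    (hψ : ∀ i j, Measurable fun z : (ι → E) × Ω' => ψ z.1 z.2 i j)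
    (hA : ∀ᵐ ω ∂P, ∀ k, ψ (x k ω) (ξ k ω) ∈ doublyStochastic ℝ ι) {γ : ℝ} (hγ : 0 < γ)
    (hdiag : ∀ᵐ ω ∂P, ∀ k i, γ ≤ ψ (x k ω) (ξ k ω) i i)
    (hstep : ∀ᵐ ω ∂P, ∀ k i, ‖x (k + 1) ω i - ∑ j, ψ (x k ω) (ξ k ω) i j • x k ω j‖ ≤ b k)
    {D : ℝ} (hD : ∀ᵐ ω ∂P, ∀ i j, ‖x 0 ω i - x 0 ω j‖ ≤ D)
    {r : ι → ι → Prop} (hr : ∀ i j, Relation.EqvGen r i j) {δ K C : ℝ} (hδ : 0 < δ) (hK : 0 < K)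
    (hC : 0 ≤ C)
    (hlink : ∀ k i j, r j i → ∀ y : ι → E,
      linkBound δ K C ‖y i - y j‖ ≤ P.real {ω | γ ≤ ψ y (ξ k ω) i j})
    (hs : C / (C + 1) < s) (hb : b =O[atTop] fun k : ℕ => ((k : ℝ) + 1) ^ (-s)) :
    Tendsto (fun k => ∫ ω, disagreement (x k ω) ∂P) atTop (𝓝 0) := by
  have hint := integrable_disagreement_of_norm_sub_le (hx 0) hD
  obtain ⟨t, hCt, hts⟩ := exists_between (lt_min hs ((div_lt_one (by positivity)).2 (lt_add_one C)))
  have ht1 : t < 1 := hts.trans_le (min_le_right _ _)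
  have ht0 : 0 ≤ t := (div_nonneg hC (by positivity)).trans hCt.le
  have hrate : C * (1 - t) < t := by
    rw [div_lt_iff₀ (by positivity)] at hCt
    linarith
  replace hb := isBigO_rpow_neg_of_le (hts.le.trans (min_le_left _ _)) hb
  obtain ⟨B, hB0, hB⟩ :=
    exists_norm_sub_le_rpow_of_perturbed_averaging (ι := ι) (E := E) ht0 ht1 hb D
  obtain ⟨c, hc0, hc1, hc⟩ := exists_le_linkBound hδ hK hC hB0 (sub_nonneg.2 ht1.le)
  refine tendsto_integral_disagreement_of_perturbed_averaging hx hξ hind hψ hint hA hγ hdiag hstep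
    hr (p := fun k => c * ((k : ℝ) + 1) ^ (-(C * (1 - t)))) (fun k => by positivity) (fun k => ?_)
    (not_summable_const_mul_rpow_neg hc0.ne' (hrate.trans ht1).le) (fun k i j hij => ?_)
    (tendsto_div_const_mul_rpow_neg hc0.ne' hrate hb)
  · exact mul_le_one₀ hc1 (by positivity) (Real.rpow_le_one_of_one_le_of_nonpos (by simp)
      (neg_nonpos.2 (mul_nonneg hC (sub_nonneg.2 ht1.le))))
  · filter_upwards [hA, hstep, hD] with ω hωA hωstep hωD
    have hgrowth := hB (fun k => x k ω) (fun k => ψ (x k ω) (ξ k ω))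
      (fun k => (mem_doublyStochastic_iff_mem_rowStochastic_and_mem_colStochastic.1 (hωA k)).1)
      hωstep hωD
    exact (hc _ _ (by simp) (norm_nonneg _) (hgrowth k i j)).trans (hlink k i j hij (x k ω))

end StateDependentLinks

section SecondMoment

variable {Ω F : Type*} [MeasurableSpace Ω] {P : Measure Ω} [NormedAddCommGroup F]

theorem memLp_two_norm_of_sq_norm_le {g : Ω → F} {V : Ω → ℝ}
    (hg : AEStronglyMeasurable g P) (hV : Integrable V P) (hgV : ∀ ω, ‖g ω‖ ^ 2 ≤ V ω) :
    MemLp (fun ω => ‖g ω‖) 2 P := by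
  refine (memLp_two_iff_integrable_sq hg.norm).2 (hV.mono' (hg.norm.pow 2) (.of_forall fun ω => ?_))
  rw [Real.norm_of_nonneg (sq_nonneg _)]
  exact hgV ω

theorem sq_integral_le_integral_sq [IsProbabilityMeasure P] {g : Ω → ℝ} (hg : MemLp g 2 P) :
    (∫ ω, g ω ∂P) ^ 2 ≤ ∫ ω, g ω ^ 2 ∂P :=
  sub_nonneg.1 ((variance_nonneg g P).trans_eq (variance_eq_sub hg))

theorem tendsto_integral_norm_of_sq_norm_le [IsProbabilityMeasure P] {g : ℕ → Ω → F}
    {V : ℕ → Ω → ℝ} (hg : ∀ k, AEStronglyMeasurable (g k) P) (hV : ∀ k, Integrable (V k) P)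
    (hgV : ∀ k ω, ‖g k ω‖ ^ 2 ≤ V k ω) (hlim : Tendsto (fun k => ∫ ω, V k ω ∂P) atTop (𝓝 0)) :
    Tendsto (fun k => ∫ ω, ‖g k ω‖ ∂P) atTop (𝓝 0) := by
  have hmem (k : ℕ) := memLp_two_norm_of_sq_norm_le (hg k) (hV k) (hgV k)
  refine squeeze_zero (fun k => integral_nonneg fun _ => norm_nonneg _)
    (fun k => Real.le_sqrt_of_sq_le ((sq_integral_le_integral_sq (hmem k)).trans ?_))
    (by simpa using hlim.sqrt)
  exact integral_mono (hmem k).integrable_sq (hV k) (hgV k)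

theorem ae_liminf_enorm_eq_zero {g : ℕ → Ω → F} (hg : ∀ k, Integrable (g k) P)
    (hlim : Tendsto (fun k => ∫ ω, ‖g k ω‖ ∂P) atTop (𝓝 0)) :
    ∀ᵐ ω ∂P, liminf (fun k => ‖g k ω‖ₑ) atTop = 0 := by
  have hmeas (k : ℕ) : AEMeasurable (fun ω => ‖g k ω‖ₑ) P := (hg k).1.enorm
  have hlim' : Tendsto (fun k => ∫⁻ ω, ‖g k ω‖ₑ ∂P) atTop (𝓝 0) := by
    simpa only [ofReal_integral_norm_eq_lintegral_enorm (hg _), ENNReal.ofReal_zero] using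
      ENNReal.tendsto_ofReal hlim
  have hfatou : ∫⁻ ω, liminf (fun k => ‖g k ω‖ₑ) atTop ∂P = 0 :=
    le_antisymm ((lintegral_liminf_le' hmeas).trans_eq hlim'.liminf_eq) zero_le
  refine (lintegral_eq_zero_iff' ?_).1 hfatou
  simp only [liminf_eq_iSup_iInf_of_nat]
  exact .iSup fun n => .biInf _ (Set.to_countable _) fun k _ => hmeas k

end SecondMoment

section Projection

variable {n : ℕ} {X : Set (EuclideanSpace ℝ (Fin n))}

theorem IsNearestPoint.inner_le_zero {u p w : EuclideanSpace ℝ (Fin n)} (hp : IsNearestPoint X u p)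
    (hcv : Convex ℝ X) (hw : w ∈ X) : inner ℝ (u - p) (w - p) ≤ 0 := by
  have : Nonempty X := ⟨⟨p, hp.1⟩⟩
  refine (norm_eq_iInf_iff_real_inner_le_zero hcv hp.1).1 (le_antisymm ?_ ?_) w hw
  · exact le_ciInf fun z => hp.2 z z.2
  · exact ciInf_le (f := fun w : X => ‖u - w‖)
      ⟨0, Set.forall_mem_range.2 fun _ => norm_nonneg _⟩ ⟨p, hp.1⟩

theorem lipschitzWith_projOn (hne : X.Nonempty) (hcl : IsClosed X) (hcv : Convex ℝ X) :
    LipschitzWith 1 (projOn X) := by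
  refine LipschitzWith.mk_one fun u w => ?_
  rw [dist_eq_norm, dist_eq_norm]
  have hu := projOn_spec hne hcl hcv u
  have hw := projOn_spec hne hcl hcv w
  set p := projOn X u
  set q := projOn X w
  have hexpand : inner ℝ (u - p) (q - p) + inner ℝ (w - q) (p - q)
      = ‖p - q‖ ^ 2 - inner ℝ (u - w) (p - q) := by
    rw [← neg_sub p q, show u - p = (u - w) + (w - q) - (p - q) by abel, inner_neg_right,
      inner_sub_left, inner_add_left, real_inner_self_eq_norm_sq]
    ring
  have hsq : ‖p - q‖ * ‖p - q‖ ≤ ‖u - w‖ * ‖p - q‖ := by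
    linarith [hu.inner_le_zero hcv hw.1, hw.inner_le_zero hcv hu.1,
      real_inner_le_norm (u - w) (p - q)]
  rcases (norm_nonneg (p - q)).eq_or_lt with hpq | hpq
  · exact hpq ▸ norm_nonneg _
  · exact le_of_mul_le_mul_right hsq hpq

theorem norm_projOn_sub_le (hcl : IsClosed X) (hcv : Convex ℝ X) {v : EuclideanSpace ℝ (Fin n)}
    (hv : v ∈ X) (u : EuclideanSpace ℝ (Fin n)) : ‖projOn X u - v‖ ≤ ‖u - v‖ := by
  have hfix : v = projOn X v := IsNearestPoint.eq_projOn hcl hcv ⟨hv, fun z _ => by simp⟩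
  simpa only [NNReal.coe_one, one_mul, dist_eq_norm, ← hfix] using
    (lipschitzWith_projOn ⟨v, hv⟩ hcl hcv).dist_le_mul u v

end Projection

theorem norm_sub_average_sq_le {m n : ℕ} (x : Fin m → EuclideanSpace ℝ (Fin n)) (i : Fin m) :
    ‖x i - average x‖ ^ 2 ≤ disagreement x := by
  have hm : (m : ℝ) ≠ 0 := Nat.cast_ne_zero.2 i.pos.ne'
  have hball : average x ∈ Metric.closedBall (x i) √(disagreement x) := by
    rw [average, Finset.smul_sum]
    refine (convex_closedBall _ _).sum_mem (fun _ _ => by positivity) ?_ fun j _ => ?_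
    · simpa using mul_inv_cancel₀ hm
    · rw [mem_closedBall_iff_norm]
      exact Real.le_sqrt_of_sq_le (norm_sub_sq_le_disagreement x j i)
  rw [mem_closedBall_iff_norm'] at hball
  exact (Real.le_sqrt (norm_nonneg _) (disagreement_nonneg x)).1 hball

theorem measurable_sub_average {m n : ℕ} {Ω : Type*} [MeasurableSpace Ω]
    {x : Ω → Fin m → EuclideanSpace ℝ (Fin n)} (hx : Measurable x) (i : Fin m) :
    Measurable fun ω => x ω i - average (x ω) := by
  have := measurable_pi_iff.1 hx
  unfold average
  fun_prop

section Past

variable {Ω Ω' : Type*} [MeasurableSpace Ω'] {ξ : ℕ → Ω → Ω'}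

/-- The σ-algebra generated by `ξ(0), …, ξ(k - 1)`, trivial for `k = 0`: what is known when the
state at time `k` is reached. It is `history ξ (k - 1)` for `k ≥ 1`. -/
@[reducible]
def past (ξ : ℕ → Ω → Ω') (k : ℕ) : MeasurableSpace Ω :=
  ⨆ r ∈ Set.Iio k, MeasurableSpace.comap (ξ r) inferInstance

theorem past_succ (ξ : ℕ → Ω → Ω') (k : ℕ) : past ξ (k + 1) = history ξ k := by
  simp only [past, history, Set.mem_Iio, Set.mem_Iic, Nat.lt_succ_iff]

theorem past_mono (ξ : ℕ → Ω → Ω') : Monotone (past ξ) :=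
  fun _ _ hkl => biSup_mono fun _ hr => lt_of_lt_of_le hr hkl

theorem measurable_past_succ (ξ : ℕ → Ω → Ω') (k : ℕ) : Measurable[past ξ (k + 1)] (ξ k) :=
  (comap_measurable (ξ k)).mono (le_iSup₂_of_le k k.lt_succ_self le_rfl) le_rfl

theorem past_le [mΩ : MeasurableSpace Ω] (hξ : ∀ k, Measurable (ξ k)) (k : ℕ) : past ξ k ≤ mΩ :=
  iSup₂_le fun r _ => (hξ r).comap_le

theorem indepFun_of_measurable_past {β : Type*} [MeasurableSpace Ω] [MeasurableSpace β]
    {P : Measure Ω} (hξ : ∀ k, Measurable (ξ k)) (hindep : iIndepFun ξ P) {k : ℕ} {x : Ω → β}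
    (hx : Measurable[past ξ k] x) : IndepFun x (ξ k) P := by
  have hpast : Indep (past ξ k)
      (⨆ r ∈ ({k} : Set ℕ), MeasurableSpace.comap (ξ r) inferInstance) P :=
    indep_iSup_of_disjoint (fun r => (hξ r).comap_le) hindep (by simp)
  rw [iSup_singleton] at hpast
  exact (IndepFun_iff_Indep x (ξ k) P).2 (indep_of_indep_of_le_left hpast hx.comap_le)

end Past

section Algorithm

variable {m n : ℕ} {Ω Ω' : Type*} {X : Fin m → Set (EuclideanSpace ℝ (Fin n))}
  {x₀ : Fin m → EuclideanSpace ℝ (Fin n)} {ξ : ℕ → Ω → Ω'}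
  {ψ : (Fin m → EuclideanSpace ℝ (Fin n)) → Ω' → Matrix (Fin m) (Fin m) ℝ}
  {α : ℕ → ℝ} {d : ℕ → Ω → Fin m → EuclideanSpace ℝ (Fin n)}

theorem state_mem (hcl : ∀ i, IsClosed (X i)) (hcv : ∀ i, Convex ℝ (X i)) (hx₀ : ∀ i, x₀ i ∈ X i)
    (k : ℕ) (ω : Ω) (i : Fin m) : state X ψ ξ α d x₀ k ω i ∈ X i := by
  cases k with
  | zero => exact hx₀ i
  | succ k => exact (projOn_spec ⟨_, hx₀ i⟩ (hcl i) (hcv i) _).1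

theorem measurable_state [MeasurableSpace Ω'] (hcl : ∀ i, IsClosed (X i))
    (hcv : ∀ i, Convex ℝ (X i)) (hx₀ : ∀ i, x₀ i ∈ X i)
    (hψ : ∀ i j, Measurable fun p : (Fin m → EuclideanSpace ℝ (Fin n)) × Ω' => ψ p.1 p.2 i j)
    (hd : ∀ k i, Measurable[history ξ k] fun ω => d k ω i) (k : ℕ) :
    Measurable[past ξ k] (state X ψ ξ α d x₀ k) := by
  induction k with
  | zero => exact @measurable_const _ _ _ (past ξ 0) x₀
  | succ k ih =>
    have hdk := hd k
    rw [← past_succ] at hdk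
    let _ : MeasurableSpace Ω := past ξ (k + 1)
    refine measurable_pi_iff.2 fun i => ?_
    exact (lipschitzWith_projOn ⟨_, hx₀ i⟩ (hcl i) (hcv i)).continuous.measurable.comp
      ((measurable_sum_smul (ih.mono (past_mono ξ k.le_succ) le_rfl) (measurable_past_succ ξ k) hψ
        i).sub ((hdk i).const_smul (α k)))

theorem norm_state_succ_sub_mix_le {X₀ : Set (EuclideanSpace ℝ (Fin n))} (hcl : IsClosed X₀)
    (hcv : Convex ℝ X₀) (hx₀ : ∀ i, x₀ i ∈ X₀) {k : ℕ} {ω : Ω}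
    (hA : commMatrix (fun _ => X₀) ψ ξ α d x₀ k ω ∈ Matrix.rowStochastic ℝ (Fin m)) (i : Fin m) :
    ‖state (fun _ => X₀) ψ ξ α d x₀ (k + 1) ω i
      - mix (commMatrix (fun _ => X₀) ψ ξ α d x₀ k ω) (state (fun _ => X₀) ψ ξ α d x₀ k ω) i‖
      ≤ ‖α k • d k ω i‖ := by
  refine (norm_projOn_sub_le hcl hcv (sum_smul_mem_of_convex hA hcv
    (state_mem (fun _ => hcl) (fun _ => hcv) hx₀ k ω) i) _).trans_eq ?_
  rw [commMatrix, mix, sub_sub_cancel_left, norm_neg]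

theorem ae_norm_state_succ_sub_mix_le [MeasurableSpace Ω] {P : Measure Ω}
    {X₀ : Set (EuclideanSpace ℝ (Fin n))} (hcl : IsClosed X₀) (hcv : Convex ℝ X₀)
    (hx₀ : ∀ i, x₀ i ∈ X₀) {L : ℝ}
    (hA : ∀ᵐ ω ∂P, ∀ k,
      commMatrix (fun _ => X₀) ψ ξ α d x₀ k ω ∈ doublyStochastic ℝ (Fin m))
    (hd : ∀ᵐ ω ∂P, ∀ k i, ‖d k ω i‖ ≤ L) :
    ∀ᵐ ω ∂P, ∀ k i, ‖state (fun _ => X₀) ψ ξ α d x₀ (k + 1) ω i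
      - mix (commMatrix (fun _ => X₀) ψ ξ α d x₀ k ω) (state (fun _ => X₀) ψ ξ α d x₀ k ω) i‖
      ≤ L * ‖α k‖ := by
  filter_upwards [hA, hd] with ω hωA hωd k i
  refine (norm_state_succ_sub_mix_le hcl hcv hx₀
    (mem_doublyStochastic_iff_mem_rowStochastic_and_mem_colStochastic.1 (hωA k)).1 i).trans ?_
  rw [norm_smul, mul_comm]
  exact mul_le_mul_of_nonneg_right (hωd k i) (norm_nonneg _)

end Algorithm

end DistSubgrad

theorem mainTheorem8_general {m n : ℕ} {Ω Ω' : Type*} [MeasurableSpace Ω] [MeasurableSpace Ω']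
    (P : Measure Ω) [IsProbabilityMeasure P] (X₀ : Set (EuclideanSpace ℝ (Fin n)))
    (hXcl : IsClosed X₀) (hXcv : Convex ℝ X₀)
    (x₀ : Fin m → EuclideanSpace ℝ (Fin n)) (hx₀ : ∀ i, x₀ i ∈ X₀)
    (ξ : ℕ → Ω → Ω') (hξ : ∀ k, Measurable (ξ k)) (hindep : iIndepFun ξ P)
    (ψ : (Fin m → EuclideanSpace ℝ (Fin n)) → Ω' → Matrix (Fin m) (Fin m) ℝ)
    (hψ : ∀ i j, Measurable fun p : (Fin m → EuclideanSpace ℝ (Fin n)) × Ω' => ψ p.1 p.2 i j)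
    (γ δ K C s L : ℝ) (hγ : 0 < γ) (hδ : 0 < δ) (hK : 0 < K) (hC : 0 ≤ C) (hs : C / (C + 1) < s)
    (α : ℕ → ℝ) (hα : α =O[atTop] fun k : ℕ => ((k : ℝ) + 1) ^ (-s))
    (d : ℕ → Ω → Fin m → EuclideanSpace ℝ (Fin n))
    (hdmeas : ∀ k i, Measurable[DistSubgrad.history ξ k] fun ω => d k ω i)
    (hdL : ∀ᵐ ω ∂P, ∀ k i, ‖d k ω i‖ ≤ L)
    (G : Digraph (Fin m)) (hG : ∀ i j, Relation.EqvGen G.Adj i j)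
    (hcomm : DistSubgrad.CommunicationModel P ψ ξ G γ δ K C)
    (hds : ∀ᵐ ω ∂P, ∀ k,
      DistSubgrad.commMatrix (fun _ => X₀) ψ ξ α d x₀ k ω ∈ doublyStochastic ℝ (Fin m))
    (hself : ∀ᵐ ω ∂P, ∀ k i,
      γ ≤ DistSubgrad.commMatrix (fun _ => X₀) ψ ξ α d x₀ k ω i i) (i : Fin m) :
    (∀ k, Integrable (fun ω => ‖DistSubgrad.state (fun _ => X₀) ψ ξ α d x₀ k ω i
      - DistSubgrad.average (DistSubgrad.state (fun _ => X₀) ψ ξ α d x₀ k ω)‖) P) ∧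
    Tendsto (fun k => ∫ ω, ‖DistSubgrad.state (fun _ => X₀) ψ ξ α d x₀ k ω i
      - DistSubgrad.average (DistSubgrad.state (fun _ => X₀) ψ ξ α d x₀ k ω)‖ ∂P) atTop (𝓝 0) ∧
    ∀ᵐ ω ∂P, liminf (fun k => ‖DistSubgrad.state (fun _ => X₀) ψ ξ α d x₀ k ω i
      - DistSubgrad.average (DistSubgrad.state (fun _ => X₀) ψ ξ α d x₀ k ω)‖ₑ) atTop = 0 := by
  have : Nonempty (Fin m) := ⟨i⟩
  have hpast := DistSubgrad.measurable_state (α := α) (fun _ => hXcl) (fun _ => hXcv) hx₀ hψ hdmeas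
  have hstep := DistSubgrad.ae_norm_state_succ_sub_mix_le hXcl hXcv hx₀ hds hdL
  set x := DistSubgrad.state (fun _ => X₀) ψ ξ α d x₀
  have hx (k : ℕ) : Measurable (x k) := (hpast k).mono (DistSubgrad.past_le hξ k) le_rfl
  have hind (k : ℕ) : IndepFun (x k) (ξ k) P :=
    DistSubgrad.indepFun_of_measurable_past hξ hindep (hpast k)
  obtain ⟨D, hD⟩ := (Set.finite_range fun p : Fin m × Fin m => ‖x₀ p.1 - x₀ p.2‖).bddAbove
  have hD₀ : ∀ᵐ ω ∂P, ∀ i j, ‖x 0 ω i - x 0 ω j‖ ≤ D := .of_forall fun _ i j => hD ⟨(i, j), rfl⟩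
  have hV := DistSubgrad.integrable_disagreement_of_perturbed_averaging hx hξ hψ
    (DistSubgrad.integrable_disagreement_of_norm_sub_le (hx 0) hD₀) hds hstep
  have hVlim := DistSubgrad.tendsto_integral_disagreement_of_linkBound hx hξ hind hψ hds hγ hself
    hstep hD₀ hG hδ hK hC (fun k i j hij => hcomm i j hij k) hs (hα.norm_left.const_mul_left L)
  have hmeas (k : ℕ) : AEStronglyMeasurable (fun ω => x k ω i - DistSubgrad.average (x k ω)) P :=
    (DistSubgrad.measurable_sub_average (hx k) i).aestronglyMeasurable
  have hVi (k : ℕ) (ω : Ω) := DistSubgrad.norm_sub_average_sq_le (x k ω) i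
  have hint (k : ℕ) : Integrable (fun ω => ‖x k ω i - DistSubgrad.average (x k ω)‖) P :=
    (DistSubgrad.memLp_two_norm_of_sq_norm_le (hmeas k) (hV k) (hVi k)).integrable one_le_two
  have hlim := DistSubgrad.tendsto_integral_norm_of_sq_norm_le hmeas hV hVi hVlim
  exact ⟨hint, hlim, DistSubgrad.ae_liminf_enorm_eq_zero
    (fun k => (integrable_norm_iff (hmeas k)).1 (hint k)) hlim⟩

theorem mainTheorem8 {m n : ℕ} {Ω Ω' : Type*} [MeasurableSpace Ω] [MeasurableSpace Ω']
    (P : Measure Ω) [IsProbabilityMeasure P]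
    -- convex objectives with bounded subgradients
    (f : Fin m → EuclideanSpace ℝ (Fin n) → ℝ)
    (hf : ∀ i, ConvexOn ℝ Set.univ (f i))
    (hL : DistSubgrad.BoundedSubgradients f)
    -- identical closed convex constraint sets, feasible initial estimates
    (X : Fin m → Set (EuclideanSpace ℝ (Fin n)))
    (X₀ : Set (EuclideanSpace ℝ (Fin n))) (hX : ∀ i, X i = X₀)
    (hXcl : IsClosed X₀) (hXcv : Convex ℝ X₀)
    (x₀ : Fin m → EuclideanSpace ℝ (Fin n)) (hx₀ : ∀ i, x₀ i ∈ X i)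
    -- Markovian communication model driven by independent noise
    (ξ : ℕ → Ω → Ω') (hξ : ∀ k, Measurable (ξ k)) (hindep : iIndepFun ξ P)
    (ψ : (Fin m → EuclideanSpace ℝ (Fin n)) → Ω' → Matrix (Fin m) (Fin m) ℝ)
    (hψ : ∀ i j, Measurable fun p : (Fin m → EuclideanSpace ℝ (Fin n)) × Ω' => ψ p.1 p.2 i j)
    -- positive stepsizes
    (α : ℕ → ℝ) (hα : ∀ k, 0 < α k) (hαlim : DistSubgrad.LimitingStepsizes α)
    -- `d_i(k)` is a nonanticipating choice of a subgradient of `f_i` at `v_i(k)`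
    (d : ℕ → Ω → Fin m → EuclideanSpace ℝ (Fin n))
    (hdmeas : ∀ k i, Measurable[DistSubgrad.history ξ k] fun ω => d k ω i)
    (hd : ∀ k ω i, DistSubgrad.IsSubgradientAt (f i)
      (DistSubgrad.mix (DistSubgrad.commMatrix X ψ ξ α d x₀ k ω)
        (DistSubgrad.state X ψ ξ α d x₀ k ω) i) (d k ω i))
    -- strongly connected backbone and link probabilities
    (G : Digraph (Fin m)) (hG : DistSubgrad.StronglyConn G)
    (γ δ K C : ℝ) (hγ : 0 < γ) (hδ : 0 < δ) (hδ1 : δ ≤ 1) (hK : 0 < K) (hC : 0 < C)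
    (hcomm : DistSubgrad.CommunicationModel P ψ ξ G γ δ K C)
    -- doubly stochastic weights and self confidence
    (hds : ∀ᵐ ω ∂P, ∀ k,
      DistSubgrad.commMatrix X ψ ξ α d x₀ k ω ∈ doublyStochastic ℝ (Fin m))
    (hself : ∀ᵐ ω ∂P, ∀ k i, γ ≤ DistSubgrad.commMatrix X ψ ξ α d x₀ k ω i i) :
    ∀ i : Fin m,
      (∀ k, Integrable (fun ω => ‖DistSubgrad.state X ψ ξ α d x₀ k ω i
        - DistSubgrad.average (DistSubgrad.state X ψ ξ α d x₀ k ω)‖) P) ∧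
      Tendsto (fun k => ∫ ω, ‖DistSubgrad.state X ψ ξ α d x₀ k ω i
        - DistSubgrad.average (DistSubgrad.state X ψ ξ α d x₀ k ω)‖ ∂P) atTop (𝓝 0) ∧
      ∀ᵐ ω ∂P, liminf (fun k => ‖DistSubgrad.state X ψ ξ α d x₀ k ω i
        - DistSubgrad.average (DistSubgrad.state X ψ ξ α d x₀ k ω)‖ₑ) atTop = 0 := by
  obtain rfl : X = fun _ => X₀ := funext hX
  obtain ⟨L, -, hL⟩ := hL
  exact mainTheorem8_general P X₀ hXcl hXcv x₀ hx₀ ξ hξ hindep ψ hψ γ δ K C 1 L hγ hδ hK hC.le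
    ((div_lt_one (by positivity)).2 (lt_add_one C)) α hαlim.isBigO d hdmeas
    (.of_forall fun ω k i => hL i _ _ (hd k ω i)) G
    (fun i j => Relation.EqvGen.reflTransGen_le_eqvGen _ _ _ (hG i j)) hcomm hds hself
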